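/- Let $k\ge 6$ be an integer. In \emph{multicolored induced $k$-edge path detection}, the input is a graph $G$ on $n$ nodes with a (not necessarily proper) coloring of its nodes with $k+1$ colors, each node knowing its own color, and the task is to decide whether $G$ contains an induced path with $k$ edges (that is, $k+1$ nodes) all of whose nodes have different colors. The problem is considered in the $\mathsf{CONGEST}$ model. The input graph is the communication graph; nodes have unique identifiers $0,\dots,n-1$ and initially know $n$, $k$, their identifier, the identifiers of their neighbors, and their color. Computation proceeds in synchronous rounds. In each round every node may send to each of its neighbors a (possibly different) message of at most $B$ bits, where $B=O(\log n)$, and local computation is unrestricted. Algorithms may use randomness, private or shared. An algorithm solves the problem in $T$ rounds on $n$-node graphs if for every input graph and coloring, with probability at least $2/3$, after $T$ rounds at least one node reports a yes-instance if the input is a yes-instance, and no node does so otherwise. \textbf{Theorem.} For any $k\ge 6$, any $\mathsf{CONGEST}$ algorithm solving multicolored induced $k$-edge path detection needs $\Omega(n/\log n)$ rounds. Precisely: for every $k\ge 6$ and every $\beta>0$ there are $c>0$ and $n_0$ such that for every $n\ge n_0$, every (deterministic or randomized) algorithm with bandwidth $B\le\beta\log n$ that solves the problem in $T$ rounds on $n$-node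 graphs satisfies $T\ge c\,n/\log n$. -/

import Mathlib

open MeasureTheory

/-- `G`, with the (not necessarily proper) node coloring `χ`, contains a multicolored induced copy
of the pattern `H`: an induced copy all of whose nodes have different colors. -/
def HasMulticoloredInducedCopy {W V C : Type*} (H : SimpleGraph W) (G : SimpleGraph V)
    (χ : V → C) : Prop :=
  ∃ f : H ↪g G, Function.Injective fun w => χ (f w)

/-- The pattern with `k` edges (hence `k + 1` nodes) that is a path; the input graph is colored
with as many colors as the pattern has nodes. -/
def HasMulticoloredInducedPath {V : Type*} (k : ℕ) (G : SimpleGraph V)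
    (χ : V → Fin (k + 1)) : Prop :=
  HasMulticoloredInducedCopy (SimpleGraph.pathGraph (k + 1)) G χ

/-- Messages: bit strings of length at most `B` (the empty string stands for silence). -/
abbrev CongestMessage (B : ℕ) : Type := {w : List Bool // w.length ≤ B}

/-- A (randomized) algorithm in the CONGEST model with bandwidth `B`, on communication graphs with
`n` nodes; the nodes carry the identifiers `0, …, n - 1`, and every node has a local input in `I`.

A node starts with the knowledge of `n`, its identifier, the identifiers of its neighbors, its
local input and the random seed `ω : Ω`. In each round it sends to each of its neighbors a message
that is a function of its local state, and then updates its state from the messages received.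
Local computation is unrestricted. The seed may be used by all nodes; independent private coins
are the case where `Ω` is a product over the nodes and node `v` reads the coordinate `v` only, and
deterministic algorithms are the case where the seed is ignored. -/
structure CongestAlgorithm (I : Type) (n B : ℕ) (Ω : Type) where
  /-- Local states of a node. -/
  State : Type
  /-- Initial state, from identifier, set of neighbors, local input and seed. -/
  init : Fin n → Set (Fin n) → I → Ω → State
  /-- The message sent to the neighbor with the given identifier. -/
  send : State → Fin n → CongestMessage B
  /-- State update; the messages received are indexed by the identifier of the sender, with
  `none` for those nodes that are not neighbors. -/
  receive : State → (Fin n → Option (CongestMessage B)) → State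
  /-- Whether a node in this state reports that the input is a yes-instance. -/
  output : State → Bool

namespace CongestAlgorithm

variable {I Ω : Type} {n B : ℕ}

open Classical in
/-- The local state of each node after `t` synchronous rounds on the graph `G` with local inputs
`x` and seed `ω`. -/
noncomputable def run (A : CongestAlgorithm I n B Ω) (G : SimpleGraph (Fin n)) (x : Fin n → I)
    (ω : Ω) : ℕ → Fin n → A.State
  | 0, v => A.init v (G.neighborSet v) (x v) ω
  | t + 1, v => A.receive (A.run G x ω t v) fun u =>
      if G.Adj v u then some (A.send (A.run G x ω t u) v) else none

/-- After `T` rounds at least one node reports a yes-instance. -/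
def Reports (A : CongestAlgorithm I n B Ω) (G : SimpleGraph (Fin n)) (x : Fin n → I)
    (T : ℕ) (ω : Ω) : Prop :=
  ∃ v, A.output (A.run G x ω T v) = true

/-- `A` solves the decision problem `P` in `T` rounds, with probability at least `2 / 3` on every
input: on yes-instances some node reports it, on no-instances no node does. (Requiring moreover
that particular nodes, or all nodes, report a yes-instance gives a more demanding notion, met by
fewer algorithms.) -/
def Solves [MeasurableSpace Ω] (A : CongestAlgorithm I n B Ω) (μ : Measure Ω)
    (P : SimpleGraph (Fin n) → (Fin n → I) → Prop) (T : ℕ) : Prop :=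
  ∀ (G : SimpleGraph (Fin n)) (x : Fin n → I), μ {ω | ¬ (A.Reports G x T ω ↔ P G x)} ≤ 1 / 3

end CongestAlgorithm

/-! The lower bound is a reduction from two-party set disjointness on `N = m * m` elements with `m`
about `n / 4`. Pairs `(j, i)` index the elements; the set `x` is encoded by non-edges between color
classes 2 and 4, the set `y` by non-edges between classes 1 and 5. The path through the colors 0, 1,
..., k in order that uses index `j` in classes 1, 2 and index `i` in classes 4, 5 is induced exactly
when `(j, i)` lies in both sets, and no other multicolored induced path exists. Classes 2, 3, 4 are
separated from the rest by a matching, so `T` rounds are simulated with at most `B * n * T` bits of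
bandwidth, while disjointness requires a number of bits linear in `N`, that is, quadratic in `n`.

The linear bound for randomized disjointness is proved from scratch by a rectangle argument. A
random set `d` splits the ground set; `u ∩ d` and `v ∩ dᶜ` are then disjoint, and inserting one `i`
into both makes them meet in exactly `i`. `sum_maskSum_mul_maskSum_le` shows that every rectangle
gives the intersecting pairs at least a constant fraction of the weight it gives the disjoint ones,
up to an exponentially small error: a family of sets in which many coordinates are biased is
exponentially small (`card_le_of_forall_rare`), so in a large rectangle most coordinates may be set
to 0 or 1 at constant cost. In `exp_le_of_disjointness_protocol` the acceptance probability, a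
nonnegative combination of rectangles, is raised to the 13th power, so that the gap between 2/3 and
1/3 beats the constant lost in the rectangle bound.

`exp_le_of_solves` obtains the rectangles from a CONGEST algorithm by cut and paste;
`exp_le_of_solves_path` plugs in the gadget. -/

/-! ### Biased coordinates in families of finite sets. -/

section Cube

open Finset

variable {ι : Type*} [Fintype ι] [DecidableEq ι]

/-- The exponential moment of the number of elements of `S` in a random set. -/
lemma sum_exp_neg_card_inter_le (S : Finset ι) :
    ∑ u : Finset ι, Real.exp (-(#(u ∩ S) : ℝ)) ≤
      2 ^ Fintype.card ι * Real.exp (-(#S : ℝ) / 8) := by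
  have h1 : ∀ u : Finset ι, Real.exp (-(#(u ∩ S) : ℝ)) =
      ∏ i ∈ u, (if i ∈ S then Real.exp (-1) else 1) := by
    intro u
    rw [prod_ite, prod_const, prod_const_one, mul_one, filter_mem_eq_inter, ← Real.exp_nat_mul]
    congr 1; ring
  have h2 : ∑ u : Finset ι, ∏ i ∈ u, (if i ∈ S then Real.exp (-1) else 1) =
      ∏ i : ι, (1 + if i ∈ S then Real.exp (-1) else 1) := by
    rw [prod_one_add, powerset_univ]
  have h3 : (2 : ℝ) ^ Fintype.card ι * Real.exp (-(#S : ℝ) / 8) =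
      ∏ i : ι, 2 * (if i ∈ S then Real.exp (-1 / 8) else 1) := by
    rw [prod_mul_distrib, prod_const, card_univ, prod_ite, prod_const, prod_const_one, mul_one,
      filter_univ_mem, ← Real.exp_nat_mul]
    congr 2; ring
  -- Each factor satisfies `1 + exp (-1) ≤ 7/4 = 2 * (1 - 1/8) ≤ 2 * exp (-1/8)`.
  have h4 : Real.exp (-1) ≤ 3 / 4 := by
    rw [Real.exp_neg, inv_le_comm₀ (Real.exp_pos _) (by norm_num)]
    linarith [Real.add_one_le_exp (1 : ℝ)]
  have h5 := Real.add_one_le_exp (-1 / 8 : ℝ)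
  rw [sum_congr rfl fun u _ => h1 u, h2, h3]
  refine prod_le_prod (fun i _ => ?_) fun i _ => ?_
  · split_ifs <;> positivity
  · split_ifs <;> linarith

/-- A family of sets in which every element of `S` is rare is exponentially small in `#S`. -/
lemma card_le_of_forall_rare (P : Finset (Finset ι)) (S : Finset ι)
    (h : ∀ i ∈ S, 16 * #{u ∈ P | i ∈ u} ≤ #P) :
    (#P : ℝ) ≤ 2 ^ Fintype.card ι * Real.exp (-(#S : ℝ) / 16) := by
  set s : ℝ := (#S : ℝ) / 16 with hs
  have h1 : ∑ u ∈ P, (#(u ∩ S) : ℝ) ≤ s * #P := by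
    have : ∑ u ∈ P, #(u ∩ S) = ∑ i ∈ S, #{u ∈ P | i ∈ u} := by
      have := sum_card_bipartiteAbove_eq_sum_card_bipartiteBelow (s := P) (t := S)
        (fun u i => i ∈ u)
      simp only [bipartiteAbove, bipartiteBelow] at this
      rw [← this]
      refine sum_congr rfl fun u _ => ?_
      rw [inter_comm, ← filter_mem_eq_inter]
    have h2 : 16 * ∑ u ∈ P, #(u ∩ S) ≤ #S * #P := by
      rw [this, mul_sum, ← smul_eq_mul (#S)]
      exact sum_le_card_nsmul _ _ _ h
    have h3 : (16 : ℝ) * ∑ u ∈ P, (#(u ∩ S) : ℝ) ≤ #S * #P := by exact_mod_cast h2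
    rw [hs]; linarith
  -- Jensen's inequality through the tangent line of `exp` at the mean bound `s`. As `#S / 8 = 2 *
  -- s`, comparison with the exponential moment leaves the factor `exp (-s)`.
  have h2 : Real.exp (-s) * #P ≤ ∑ u ∈ P, Real.exp (-(#(u ∩ S) : ℝ)) := by
    calc Real.exp (-s) * #P ≤ Real.exp (-s) * ∑ u ∈ P, (s - #(u ∩ S) + 1) := by
          refine mul_le_mul_of_nonneg_left ?_ (Real.exp_pos _).le
          rw [sum_add_distrib, sum_sub_distrib, sum_const, sum_const]
          simp only [nsmul_eq_mul]
          linarith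
      _ ≤ _ := by
          rw [mul_sum]
          refine sum_le_sum fun u _ => ?_
          have := Real.add_one_le_exp (s - #(u ∩ S))
          calc _ ≤ Real.exp (-s) * Real.exp (s - #(u ∩ S)) :=
                mul_le_mul_of_nonneg_left this (Real.exp_pos _).le
            _ = _ := by rw [← Real.exp_add]; congr 1; ring
  have h3 : ∑ u ∈ P, Real.exp (-(#(u ∩ S) : ℝ)) ≤ _ :=
    (sum_le_univ_sum_of_nonneg fun u => (Real.exp_pos _).le).trans (sum_exp_neg_card_inter_le S)
  have h4 := mul_le_mul_of_nonneg_left (h2.trans h3) (Real.exp_pos s).le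
  rw [← mul_assoc, ← Real.exp_add, add_neg_cancel, Real.exp_zero, one_mul] at h4
  refine h4.trans (le_of_eq ?_)
  rw [mul_left_comm, ← Real.exp_add]
  congr 2; rw [hs]; ring

/-- Either `S` has at most a 1/256 fraction of the coordinates, or the preceding bound makes `P`
exponentially small; 4096 is 16 * 256. The product form covers both cases without a case distinction
later. -/
lemma card_mul_card_le_of_forall_rare (P : Finset (Finset ι)) (S : Finset ι)
    (h : ∀ i ∈ S, 16 * #{u ∈ P | i ∈ u} ≤ #P) :
    (#P : ℝ) * #S ≤ Fintype.card ι / 256 * #P +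
      Fintype.card ι * (2 ^ Fintype.card ι * Real.exp (-(Fintype.card ι : ℝ) / 4096)) := by
  have hS : (#S : ℝ) ≤ Fintype.card ι := by exact_mod_cast card_le_univ S
  rcases le_total (#S : ℝ) (Fintype.card ι / 256) with h1 | h1
  · have := mul_le_mul_of_nonneg_left h1 (Nat.cast_nonneg (α := ℝ) #P)
    have : (0 : ℝ) ≤ Fintype.card ι *
      (2 ^ Fintype.card ι * Real.exp (-(Fintype.card ι : ℝ) / 4096)) := by positivity
    linarith
  · have h2 := card_le_of_forall_rare P S h
    have h3 : (#P : ℝ) ≤ 2 ^ Fintype.card ι * Real.exp (-(Fintype.card ι : ℝ) / 4096) := by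
      refine h2.trans (mul_le_mul_of_nonneg_left (Real.exp_le_exp.2 ?_) (by positivity))
      linarith
    have h4 := mul_le_mul hS h3 (by positivity) (by positivity)
    have : (0 : ℝ) ≤ Fintype.card ι / 256 * #P := by positivity
    linarith

/-- The same for families in which the elements of `S` are rarely missing. -/
lemma card_mul_card_le_of_forall_rarely_missing (P : Finset (Finset ι)) (S : Finset ι)
    (h : ∀ i ∈ S, 16 * #{u ∈ P | i ∉ u} ≤ #P) :
    (#P : ℝ) * #S ≤ Fintype.card ι / 256 * #P +
      Fintype.card ι * (2 ^ Fintype.card ι * Real.exp (-(Fintype.card ι : ℝ) / 4096)) := by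
  have h0 : #(P.map ⟨compl, compl_injective⟩) = #P := card_map _
  rw [← h0]
  refine card_mul_card_le_of_forall_rare _ S fun i hi => ?_
  rw [h0, filter_map, card_map]
  simpa [Function.comp_def] using h i hi

/-- A function on sets that ignores whether `i` is an element. -/
lemma sum_eq_two_mul_sum_mem (i : ι) (φ : Finset ι → ℝ) (h : ∀ u, φ (insert i u) = φ u) :
    ∑ u, φ u = 2 * ∑ u with i ∈ u, φ u ∧ ∑ u, φ u = 2 * ∑ u with i ∉ u, φ u := by
  have h1 : ∑ u with i ∈ u, φ u = ∑ u with i ∉ u, φ u := by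
    refine sum_bij' (fun u _ => u.erase i) (fun u _ => insert i u) ?_ ?_ ?_ ?_ ?_
    · simp
    · simp
    · intro u hu; exact insert_erase (by simpa using hu)
    · intro u hu; exact erase_insert (by simpa using hu)
    · intro u hu; rw [← h (u.erase i), insert_erase (by simpa using hu)]
  have h2 := sum_filter_add_sum_filter_not univ (fun u : Finset ι => i ∈ u) φ
  constructor <;> linarith

/-- The weight of a random subset of `d`. -/
def maskSum (a : Finset ι → ℝ) (d : Finset ι) : ℝ := ∑ u, a (u ∩ d)

/-- The weight of a random subset of `d` with `i` added. -/
def putSum (a : Finset ι → ℝ) (i : ι) (d : Finset ι) : ℝ := ∑ u, a (insert i (u ∩ d))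

/-- The weight of a random subset of `d` with `i` removed. -/
def dropSum (a : Finset ι → ℝ) (i : ι) (d : Finset ι) : ℝ := ∑ u, a ((u ∩ d).erase i)

lemma putSum_insert (a : Finset ι → ℝ) (i : ι) (d : Finset ι) :
    putSum a i (insert i d) = putSum a i d := by
  unfold putSum
  refine sum_congr rfl fun u _ => congrArg a ?_
  ext j; simp only [mem_insert, mem_inter]; tauto

lemma dropSum_insert (a : Finset ι → ℝ) (i : ι) (d : Finset ι) :
    dropSum a i (insert i d) = dropSum a i d := by
  unfold dropSum
  refine sum_congr rfl fun u _ => congrArg a ?_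
  ext j; simp only [mem_erase, mem_insert, mem_inter]; tauto

lemma dropSum_of_notMem (a : Finset ι → ℝ) {i : ι} {d : Finset ι} (h : i ∉ d) :
    dropSum a i d = maskSum a d := by
  unfold dropSum maskSum
  refine sum_congr rfl fun u _ => congrArg a (erase_eq_of_notMem ?_)
  simp [h]

lemma putSum_of_mem (a : Finset ι → ℝ) {i : ι} {d : Finset ι} (h : i ∈ d) :
    putSum a i d = 2 * ∑ u with i ∈ u, a (u ∩ d) := by
  unfold putSum
  rw [(sum_eq_two_mul_sum_mem i (fun u => a (insert i (u ∩ d))) fun u => ?_).1]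
  · congr 1
    refine sum_congr rfl fun u hu => congrArg a (insert_eq_of_mem ?_)
    simpa [h] using hu
  · refine congrArg a ?_
    ext j; simp only [mem_insert, mem_inter]; tauto

lemma dropSum_of_mem (a : Finset ι → ℝ) {i : ι} (d : Finset ι) :
    dropSum a i d = 2 * ∑ u with i ∉ u, a (u ∩ d) := by
  unfold dropSum
  rw [(sum_eq_two_mul_sum_mem i (fun u => a ((u ∩ d).erase i)) fun u => ?_).2]
  · congr 1
    refine sum_congr rfl fun u hu => congrArg a (erase_eq_of_notMem ?_)
    simp only [mem_filter, mem_univ, true_and] at hu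
    simp [hu]
  · refine congrArg a ?_
    ext j; simp only [mem_erase, mem_insert, mem_inter]; tauto

lemma putSum_add_dropSum (a : Finset ι → ℝ) {i : ι} {d : Finset ι} (h : i ∈ d) :
    putSum a i d + dropSum a i d = 2 * maskSum a d := by
  rw [putSum_of_mem a h, dropSum_of_mem, ← mul_add, sum_filter_add_sum_filter_not, maskSum]

omit [Fintype ι] [DecidableEq ι] in
lemma nonneg_of_zero_or_one {a : Finset ι → ℝ} (ha : ∀ u, a u = 0 ∨ a u = 1) (u : Finset ι) :
    0 ≤ a u := by
  rcases ha u with h | h <;> simp [h]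

section Indicator

variable {a : Finset ι → ℝ} (ha : ∀ u, a u = 0 ∨ a u = 1)
include ha

lemma maskSum_nonneg (d : Finset ι) : 0 ≤ maskSum a d :=
  sum_nonneg fun _ _ => nonneg_of_zero_or_one ha _

lemma putSum_nonneg (i : ι) (d : Finset ι) : 0 ≤ putSum a i d :=
  sum_nonneg fun _ _ => nonneg_of_zero_or_one ha _

lemma dropSum_nonneg (i : ι) (d : Finset ι) : 0 ≤ dropSum a i d :=
  sum_nonneg fun _ _ => nonneg_of_zero_or_one ha _

lemma sum_filter_eq_card (d : Finset ι) (p : Finset ι → Prop) [DecidablePred p] :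
    ∑ u with p u, a (u ∩ d) = #{u ∈ ({u | a (u ∩ d) = 1} : Finset (Finset ι)) | p u} := by
  rw [filter_comm, card_filter, Nat.cast_sum]
  refine sum_congr rfl fun u _ => ?_
  rcases ha (u ∩ d) with h | h <;> simp [h]

lemma maskSum_eq_card (d : Finset ι) :
    maskSum a d = #({u | a (u ∩ d) = 1} : Finset (Finset ι)) := by
  have := sum_filter_eq_card ha d (fun _ => True)
  simpa [maskSum] using this

lemma maskSum_le (d : Finset ι) : maskSum a d ≤ 2 ^ Fintype.card ι := by
  rw [maskSum_eq_card ha]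
  have := card_le_univ ({u | a (u ∩ d) = 1} : Finset (Finset ι))
  rw [Fintype.card_finset] at this
  exact_mod_cast this

/-- The elements of `d` that are rare in the random subset have little total weight. -/
lemma maskSum_mul_card_put_le (d : Finset ι) :
    maskSum a d * #{i ∈ d | 15 * putSum a i d ≤ dropSum a i d} ≤
      Fintype.card ι / 256 * maskSum a d +
      Fintype.card ι * (2 ^ Fintype.card ι * Real.exp (-(Fintype.card ι : ℝ) / 4096)) := by
  rw [maskSum_eq_card ha]
  refine card_mul_card_le_of_forall_rare _ _ fun i hi => ?_
  obtain ⟨hi, h⟩ := mem_filter.1 hi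
  have h1 := putSum_add_dropSum a hi
  have h2 := putSum_of_mem a hi
  rw [sum_filter_eq_card ha] at h2
  rw [maskSum_eq_card ha] at h1
  -- `15 * putSum ≤ dropSum` means that `putSum` is at most 1/16 of the sum of the two, which is
  -- twice the total weight.
  have : (16 : ℝ) * #{u ∈ ({u | a (u ∩ d) = 1} : Finset (Finset ι)) | i ∈ u} ≤
    #({u | a (u ∩ d) = 1} : Finset (Finset ι)) := by linarith
  exact_mod_cast this

lemma maskSum_mul_card_drop_le (d : Finset ι) :
    maskSum a d * #{i ∈ d | 8 * dropSum a i d ≤ maskSum a d} ≤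
      Fintype.card ι / 256 * maskSum a d +
      Fintype.card ι * (2 ^ Fintype.card ι * Real.exp (-(Fintype.card ι : ℝ) / 4096)) := by
  rw [maskSum_eq_card ha]
  refine card_mul_card_le_of_forall_rarely_missing _ _ fun i hi => ?_
  obtain ⟨hi, h⟩ := mem_filter.1 hi
  have h2 := dropSum_of_mem a (i := i) d
  rw [sum_filter_eq_card ha] at h2
  have : (16 : ℝ) * #{u ∈ ({u | a (u ∩ d) = 1} : Finset (Finset ι)) | i ∉ u} ≤
    #({u | a (u ∩ d) = 1} : Finset (Finset ι)) := by linarith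
  exact_mod_cast this

end Indicator

end Cube
-- The rectangle bound for disjointness.
section Rectangle

open Finset

variable {ι : Type*} [Fintype ι] [DecidableEq ι]

lemma dropSum_erase (a : Finset ι → ℝ) (i : ι) (d : Finset ι) :
    dropSum a i (d.erase i) = dropSum a i d := by
  rw [← dropSum_insert, ← dropSum_insert a i d]
  exact congrArg _ (by grind)

lemma sum_comp_compl (φ : Finset ι → ℝ) : ∑ d, φ dᶜ = ∑ d, φ d :=
  (compl_involutive (α := Finset ι)).bijective.sum_comp φ

variable {a b : Finset ι → ℝ} (ha : ∀ u, a u = 0 ∨ a u = 1) (hb : ∀ u, b u = 0 ∨ b u = 1)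
include ha hb

/-- Most of the weight of a large rectangle remains when a random coordinate is set to zero. -/
lemma le_sum_dropSum_mul_dropSum (d : Finset ι) :
    Fintype.card ι / 8 * (127 / 128 * (maskSum a d * maskSum b dᶜ) -
      2 * 4 ^ Fintype.card ι * Real.exp (-(Fintype.card ι : ℝ) / 4096)) ≤
      ∑ i, dropSum a i d * dropSum b i dᶜ := by
  have h0a := maskSum_nonneg ha d
  have h0b := maskSum_nonneg hb dᶜ
  have hA := mul_le_mul_of_nonneg_left (maskSum_mul_card_drop_le ha d) h0b
  have hB := mul_le_mul_of_nonneg_left (maskSum_mul_card_drop_le hb dᶜ) h0a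
  set e := Real.exp (-(Fintype.card ι : ℝ) / 4096) with he
  have he0 : 0 < e := Real.exp_pos _
  set SA : Finset ι := {i ∈ d | 8 * dropSum a i d ≤ maskSum a d} with hSA
  set SB : Finset ι := {i ∈ dᶜ | 8 * dropSum b i dᶜ ≤ maskSum b dᶜ} with hSB
  -- Each `i` lies in exactly one of `d` and `dᶜ`, so removing it alters only one factor, which
  -- keeps at least 1/8 of its weight unless `i` is exceptional. The two exceptional sets cost `N /
  -- 256` each, whence 127/128.
  have h1 : ∀ i, maskSum a d * maskSum b dᶜ / 8 *
      (1 - (if i ∈ SA then 1 else 0) - (if i ∈ SB then 1 else 0)) ≤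
      dropSum a i d * dropSum b i dᶜ := by
    intro i
    have hda := dropSum_nonneg ha i d
    have hdb := dropSum_nonneg hb i dᶜ
    have hp := mul_nonneg hda hdb
    have hab := mul_nonneg h0a h0b
    by_cases hi : i ∈ d
    · have hi2 : i ∉ dᶜ := by simpa using hi
      have hnB : i ∉ SB := fun h => hi2 (mem_filter.1 h).1
      rw [if_neg hnB]
      by_cases hA : i ∈ SA
      · rw [if_pos hA]; linarith
      · rw [if_neg hA, dropSum_of_notMem b hi2]
        have h2 : maskSum a d ≤ 8 * dropSum a i d := by
          by_contra h; exact hA (mem_filter.2 ⟨hi, by linarith⟩)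
        nlinarith [mul_le_mul_of_nonneg_right h2 h0b]
    · have hi2 : i ∈ dᶜ := by simpa using hi
      have hnA : i ∉ SA := fun h => hi (mem_filter.1 h).1
      rw [if_neg hnA]
      by_cases hB : i ∈ SB
      · rw [if_pos hB]; linarith
      · rw [if_neg hB, dropSum_of_notMem a hi]
        have h2 : maskSum b dᶜ ≤ 8 * dropSum b i dᶜ := by
          by_contra h; exact hB (mem_filter.2 ⟨hi2, by linarith⟩)
        nlinarith [mul_le_mul_of_nonneg_left h2 h0a]
  have h2 := sum_le_sum fun i (_ : i ∈ (univ : Finset ι)) => h1 i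
  rw [← mul_sum, sum_sub_distrib, sum_sub_distrib, sum_boole, sum_boole, filter_univ_mem,
    filter_univ_mem, sum_const, card_univ, nsmul_eq_mul, mul_one] at h2
  refine le_trans ?_ h2
  have hla := maskSum_le ha d
  have hlb := maskSum_le hb dᶜ
  have h4 : (4 : ℝ) ^ Fintype.card ι = 2 ^ Fintype.card ι * 2 ^ Fintype.card ι := by
    rw [← mul_pow]; norm_num
  rw [h4]
  set M : ℝ := 2 ^ Fintype.card ι
  have hN : (0 : ℝ) ≤ Fintype.card ι := Nat.cast_nonneg _
  set N : ℝ := (Fintype.card ι : ℝ)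
  have k1 := mul_le_mul_of_nonneg_right hlb (show 0 ≤ N * (M * e) by positivity)
  have k2 := mul_le_mul_of_nonneg_right hla (show 0 ≤ N * (M * e) by positivity)
  linarith

/-- Slots in which adding `i` makes the first factor much smaller carry little weight. -/
lemma sum_dropSum_mul_dropSum_of_rare_le :
    ∑ i, ∑ d, (if 15 * putSum a i d ≤ dropSum a i d then dropSum a i d * dropSum b i dᶜ else 0) ≤
      4 * (Fintype.card ι / 256 * ∑ d, maskSum a d * maskSum b dᶜ +
        Fintype.card ι * 8 ^ Fintype.card ι * Real.exp (-(Fintype.card ι : ℝ) / 4096)) := by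
  set e := Real.exp (-(Fintype.card ι : ℝ) / 4096) with he
  have he0 : 0 < e := Real.exp_pos _
  have h1 : ∀ i, ∑ d, (if 15 * putSum a i d ≤ dropSum a i d then
      dropSum a i d * dropSum b i dᶜ else 0) ≤
      ∑ d, if i ∈ d ∧ 15 * putSum a i d ≤ dropSum a i d then
        4 * (maskSum a d * maskSum b dᶜ) else 0 := by
    intro i
    -- The summand does not depend on whether `i` is in `d`, so `i ∈ d` may be assumed at the cost
    -- of a factor 2. Then `dropSum a i d ≤ 2 * maskSum a d` gives the other factor 2.
    rw [(sum_eq_two_mul_sum_mem i (fun d => if 15 * putSum a i d ≤ dropSum a i d then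
      dropSum a i d * dropSum b i dᶜ else 0) fun d => ?_).1, sum_filter, mul_sum]
    · refine sum_le_sum fun d _ => ?_
      by_cases hi : i ∈ d
      · by_cases hp : 15 * putSum a i d ≤ dropSum a i d
        · have hi2 : i ∉ dᶜ := by simpa using hi
          simp only [hi, hp, and_self, if_true]
          rw [dropSum_of_notMem b hi2]
          have := putSum_add_dropSum a hi
          have h3 := putSum_nonneg ha i d
          have h4 : dropSum a i d ≤ 2 * maskSum a d := by linarith
          linarith [mul_le_mul_of_nonneg_right h4 (maskSum_nonneg hb dᶜ)]
        · simp [hp]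
      · simp [hi]
    · rw [putSum_insert, dropSum_insert, compl_insert, dropSum_erase]
  refine (sum_le_sum fun i _ => h1 i).trans ?_
  rw [sum_comm, mul_sum]
  have h2 : (Fintype.card ι : ℝ) * 8 ^ Fintype.card ι * e = ∑ d : Finset ι,
      2 ^ Fintype.card ι * (Fintype.card ι * (2 ^ Fintype.card ι * e)) := by
    rw [sum_const, card_univ, Fintype.card_finset, nsmul_eq_mul]
    have : (8 : ℝ) ^ Fintype.card ι =
      2 ^ Fintype.card ι * 2 ^ Fintype.card ι * 2 ^ Fintype.card ι := by
      rw [← mul_pow, ← mul_pow]; norm_num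
    rw [this]; push_cast; ring
  rw [h2, ← sum_add_distrib, mul_sum]
  refine sum_le_sum fun d _ => ?_
  rw [← sum_filter, sum_const, nsmul_eq_mul, ← filter_filter, filter_univ_mem]
  have h3 := mul_le_mul_of_nonneg_right (maskSum_mul_card_put_le ha d) (maskSum_nonneg hb dᶜ)
  have h4 := mul_le_mul_of_nonneg_right (maskSum_le hb dᶜ)
    (show 0 ≤ (Fintype.card ι : ℝ) * (2 ^ Fintype.card ι * e) by positivity)
  linarith

/-- A rectangle contains not much fewer pairs that intersect in one element than disjoint pairs,
up to an exponentially small error. -/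
theorem sum_maskSum_mul_maskSum_le :
    Fintype.card ι / 3600 * ∑ d, maskSum a d * maskSum b dᶜ ≤
      ∑ i, ∑ d, putSum a i d * putSum b i dᶜ +
        Fintype.card ι * 8 ^ Fintype.card ι * Real.exp (-(Fintype.card ι : ℝ) / 4096) := by
  have hA := sum_dropSum_mul_dropSum_of_rare_le ha hb
  have hB := sum_dropSum_mul_dropSum_of_rare_le hb ha
  have hD := sum_le_sum fun d (_ : d ∈ univ) => le_sum_dropSum_mul_dropSum ha hb d
  set e := Real.exp (-(Fintype.card ι : ℝ) / 4096) with he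
  have he0 : 0 < e := Real.exp_pos _
  have e1 : ∑ d, maskSum b d * maskSum a dᶜ = ∑ d, maskSum a d * maskSum b dᶜ := by
    rw [← sum_comp_compl]
    simp [mul_comm]
  have e2 : ∑ i, ∑ d, (if 15 * putSum b i d ≤ dropSum b i d then
      dropSum b i d * dropSum a i dᶜ else 0) = ∑ i, ∑ d,
      (if 15 * putSum b i dᶜ ≤ dropSum b i dᶜ then dropSum a i d * dropSum b i dᶜ else 0) := by
    refine sum_congr rfl fun i _ => ?_
    rw [← sum_comp_compl]
    simp [mul_comm]
  rw [e1, e2] at hB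
  rw [sum_comm, ← mul_sum, sum_sub_distrib, ← mul_sum, sum_const, card_univ,
    Fintype.card_finset, nsmul_eq_mul] at hD
  have h8 : ((2 ^ Fintype.card ι : ℕ) : ℝ) * (2 * 4 ^ Fintype.card ι * e) =
      2 * (8 ^ Fintype.card ι * e) := by
    have : (8 : ℝ) ^ Fintype.card ι = 2 ^ Fintype.card ι * 4 ^ Fintype.card ι := by
      rw [← mul_pow]; norm_num
    rw [this]; push_cast; ring
  rw [h8] at hD
  -- Where neither factor is rare, each loses less than a factor 15 when `i` is put in, so 225 in
  -- total. What remains is `127/1024 - 2 * 4/256 = 95/1024 ≥ 1/16`, and `16 * 225 = 3600`.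
  have hR : ∑ i, ∑ d, (dropSum a i d * dropSum b i dᶜ -
      (if 15 * putSum a i d ≤ dropSum a i d then dropSum a i d * dropSum b i dᶜ else 0) -
      (if 15 * putSum b i dᶜ ≤ dropSum b i dᶜ then dropSum a i d * dropSum b i dᶜ else 0)) ≤
      ∑ i, ∑ d, 225 * (putSum a i d * putSum b i dᶜ) := by
    refine sum_le_sum fun i _ => sum_le_sum fun d _ => ?_
    have p1 := putSum_nonneg ha i d
    have p2 := putSum_nonneg hb i dᶜ
    have p3 := dropSum_nonneg ha i d
    have p4 := dropSum_nonneg hb i dᶜ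
    have p5 := mul_nonneg p1 p2
    have p6 := mul_nonneg p3 p4
    split_ifs with c1 c2 c2
    · linarith
    · linarith
    · linarith
    · push Not at c1 c2
      have := mul_le_mul c1.le c2.le p4 (by linarith)
      linarith
  simp only [sum_sub_distrib, ← mul_sum] at hR
  have hs : 0 ≤ ∑ d, maskSum a d * maskSum b dᶜ :=
    sum_nonneg fun d _ => mul_nonneg (maskSum_nonneg ha _) (maskSum_nonneg hb _)
  have hN : (0 : ℝ) ≤ Fintype.card ι := Nat.cast_nonneg _
  have hNs := mul_nonneg hN hs
  have hE : 0 ≤ (Fintype.card ι : ℝ) * 8 ^ Fintype.card ι * e := by positivity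
  linarith

end Rectangle
-- From rectangles to randomized protocols for disjointness.
section Amplification

open Finset

/-- A seed space may be replaced by finitely many weighted seeds. -/
lemma exists_finite_seeds {Ω X : Type*} [MeasurableSpace Ω] (μ : Measure Ω)
    [IsProbabilityMeasure μ] [Fintype X] [DecidableEq X] (bad : X → Set Ω)
    (h : ∀ x, μ (bad x) ≤ 1 / 3) :
    ∃ (w : Finset X → ℝ) (seed : Finset X → Ω), (∀ q, 0 ≤ w q) ∧ ∑ q, w q = 1 ∧
      ∀ x, ∀ s : Finset (Finset X), (∀ q ∈ s, seed q ∈ bad x) → ∑ q ∈ s, w q ≤ 1 / 3 := by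
  classical
  have : Nonempty Ω := by
    by_contra hne
    rw [not_nonempty_iff] at hne
    simpa [Set.eq_empty_of_isEmpty] using measure_univ (μ := μ)
  -- The bad sets need not be measurable, so measurable hulls of equal measure replace them. Seeds
  -- are then grouped by the set of inputs whose hull contains them.
  set H : X → Set Ω := fun x => toMeasurable μ (bad x) with hH
  have hHm : ∀ x, MeasurableSet (H x) := fun x => measurableSet_toMeasurable _ _
  set pat : Ω → Finset X := fun ω => {x | ω ∈ H x} with hpat
  have hcell : ∀ q, MeasurableSet (pat ⁻¹' {q}) := by
    intro q
    have : pat ⁻¹' {q} = ⋂ x, {ω | ω ∈ H x ↔ x ∈ q} := by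
      ext ω
      simp only [Set.mem_preimage, Set.mem_singleton_iff, Set.mem_iInter, Set.mem_ofPred_eq, hpat,
        Finset.ext_iff, mem_filter, mem_univ, true_and]
    rw [this]
    refine MeasurableSet.iInter fun x => ?_
    by_cases hx : x ∈ q
    · simpa [hx] using hHm x
    · simp only [hx, iff_false]
      exact (hHm x).compl
  have hsum : ∀ s : Finset (Finset X), ∑ q ∈ s, μ.real (pat ⁻¹' {q}) = μ.real (pat ⁻¹' s) := by
    intro s
    rw [← measureReal_biUnion_finset]
    · congr 1; ext ω; simp
    · intro p _ q _ hpq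
      exact Set.disjoint_left.2 fun ω hp hq => hpq (hp.symm.trans hq)
    · exact fun q _ => hcell q
  refine ⟨fun q => μ.real (pat ⁻¹' {q}), fun q =>
    if hq : (pat ⁻¹' {q}).Nonempty then hq.some else Classical.arbitrary Ω,
    fun q => measureReal_nonneg, ?_, fun x s hs => ?_⟩
  · rw [hsum]; simp
  · calc ∑ q ∈ s, μ.real (pat ⁻¹' {q})
        = ∑ q ∈ s with (pat ⁻¹' {q}).Nonempty, μ.real (pat ⁻¹' {q}) := by
          rw [sum_filter]
          refine sum_congr rfl fun q _ => ?_
          split_ifs with hq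
          · rfl
          · rw [Set.not_nonempty_iff_eq_empty.1 hq]; simp
      _ = _ := hsum _
      _ ≤ μ.real (H x) := by
          refine measureReal_mono fun ω hω => ?_
          simp only [Set.mem_preimage, mem_coe, mem_filter] at hω
          obtain ⟨h1, h2⟩ := hω
          have h3 := hs _ h1
          beta_reduce at h3
          rw [dif_pos h2] at h3
          have h4 : h2.some ∈ H x := subset_toMeasurable _ _ h3
          have h5 : pat h2.some = pat ω := h2.some_mem
          have h6 : x ∈ pat h2.some := by simpa [hpat] using h4
          rw [h5] at h6
          simpa [hpat] using h6
      _ ≤ 1 / 3 := by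
          rw [measureReal_def, hH, measure_toMeasurable]
          have := ENNReal.toReal_mono (by simp) (h x)
          simpa using this

variable {ι : Type*} [Fintype ι] [DecidableEq ι]

lemma maskSum_mul_maskSum (a b : Finset ι → ℝ) (d : Finset ι) :
    maskSum a d * maskSum b dᶜ = ∑ u, ∑ v, a (u ∩ d) * b (v ∩ dᶜ) := by
  rw [maskSum, maskSum, sum_mul_sum]

lemma putSum_mul_putSum (a b : Finset ι → ℝ) (i : ι) (d : Finset ι) :
    putSum a i d * putSum b i dᶜ =
      ∑ u, ∑ v, a (insert i (u ∩ d)) * b (insert i (v ∩ dᶜ)) := by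
  rw [putSum, putSum, sum_mul_sum]

/-- The rectangle bound for nonnegative combinations of rectangles. -/
lemma sum_combination_le {J : Type*} [Fintype J] (c : J → ℝ) (hc : ∀ j, 0 ≤ c j)
    (a b : J → Finset ι → ℝ) (ha : ∀ j u, a j u = 0 ∨ a j u = 1)
    (hb : ∀ j u, b j u = 0 ∨ b j u = 1) (F : Finset ι → Finset ι → ℝ)
    (hF : ∀ x y, F x y = ∑ j, c j * (a j x * b j y)) :
    Fintype.card ι / 3600 * ∑ d : Finset ι, ∑ u, ∑ v, F (u ∩ d) (v ∩ dᶜ) ≤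
      ∑ i, ∑ d : Finset ι, ∑ u, ∑ v, F (insert i (u ∩ d)) (insert i (v ∩ dᶜ)) +
        (∑ j, c j) * (Fintype.card ι * 8 ^ Fintype.card ι *
          Real.exp (-(Fintype.card ι : ℝ) / 4096)) := by
  have h1 : ∑ d : Finset ι, ∑ u, ∑ v, F (u ∩ d) (v ∩ dᶜ) =
      ∑ j, c j * ∑ d, maskSum (a j) d * maskSum (b j) dᶜ := by
    simp only [hF, maskSum_mul_maskSum, mul_sum]
    rw [sum_comm]
    refine Eq.symm ?_
    rw [sum_comm]
    simp only [sum_comm (s := (univ : Finset J))]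
    rw [sum_comm]
  have h2 : ∑ i, ∑ d : Finset ι, ∑ u, ∑ v, F (insert i (u ∩ d)) (insert i (v ∩ dᶜ)) =
      ∑ j, c j * ∑ i, ∑ d, putSum (a j) i d * putSum (b j) i dᶜ := by
    simp only [hF, putSum_mul_putSum, mul_sum]
    simp only [sum_comm (s := (univ : Finset J))]
  rw [h1, h2, mul_sum, sum_mul, ← sum_add_distrib]
  refine sum_le_sum fun j _ => ?_
  have := mul_le_mul_of_nonneg_left (sum_maskSum_mul_maskSum_le (ha j) (hb j)) (hc j)
  linarith

/-- Randomized protocols for set disjointness with at most `card Θ` transcripts: the communication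
is linear in the size of the ground set. -/
theorem exp_le_of_disjointness_protocol {S Θ : Type*} [Fintype S] [Fintype Θ]
    (w : S → ℝ) (hw : ∀ s, 0 ≤ w s) (hw1 : ∑ s, w s = 1)
    (a b : S → Θ → Finset ι → ℝ) (ha : ∀ s θ x, a s θ x = 0 ∨ a s θ x = 1)
    (hb : ∀ s θ y, b s θ y = 0 ∨ b s θ y = 1)
    (hdisj : ∀ x y, Disjoint x y → 2 / 3 ≤ ∑ s, ∑ θ, w s * (a s θ x * b s θ y))
    (hinter : ∀ x y, ¬ Disjoint x y → ∑ s, ∑ θ, w s * (a s θ x * b s θ y) ≤ 1 / 3)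
    (hι : 0 < Fintype.card ι) :
    Real.exp ((Fintype.card ι : ℝ) / 4096) ≤ (3 * Fintype.card Θ : ℝ) ^ 13 := by
  set q : Finset ι → Finset ι → ℝ := fun x y => ∑ s, ∑ θ, w s * (a s θ x * b s θ y) with hq
  have hprod : ∀ (f : (Fin 13 → S × Θ) → Fin 13 → ℝ) p, (∀ t, f p t = 0 ∨ f p t = 1) →
      ∏ t, f p t = 0 ∨ ∏ t, f p t = 1 := by
    intro f p h
    by_cases h0 : ∃ t, f p t = 0
    · obtain ⟨t, ht⟩ := h0
      exact Or.inl (prod_eq_zero (mem_univ t) ht)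
    · push Not at h0
      exact Or.inr (prod_eq_one fun t _ => (h t).resolve_left (h0 t))
  -- Thirteen independent repetitions that must all accept: a product of rectangles is again a
  -- rectangle, and the coefficients add up to `card Θ ^ 13`.
  have key := sum_combination_le (J := Fin 13 → S × Θ) (fun p => ∏ t, w (p t).1)
    (fun p => prod_nonneg fun t _ => hw _) (fun p x => ∏ t, a (p t).1 (p t).2 x)
    (fun p y => ∏ t, b (p t).1 (p t).2 y)
    (fun p x => hprod (fun p t => a (p t).1 (p t).2 x) p fun t => ha _ _ _)
    (fun p y => hprod (fun p t => b (p t).1 (p t).2 y) p fun t => hb _ _ _)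
    (fun x y => q x y ^ 13) fun x y => by
      simp only [hq]
      rw [← Fintype.sum_prod_type' (fun s θ => w s * (a s θ x * b s θ y)), sum_pow']
      simp [prod_mul_distrib]
  have hc : ∑ p : Fin 13 → S × Θ, ∏ t, w (p t).1 = (Fintype.card Θ : ℝ) ^ 13 := by
    have := sum_pow' (univ : Finset (S × Θ)) (fun p => w p.1) 13
    rw [Fintype.piFinset_univ] at this
    rw [← this, Fintype.sum_prod_type]
    simp [← mul_sum, hw1]
  rw [hc] at key
  set e := Real.exp (-(Fintype.card ι : ℝ) / 4096) with he
  have hN : (0 : ℝ) < Fintype.card ι := by exact_mod_cast hι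
  have h8 : (8 : ℝ) ^ Fintype.card ι =
      2 ^ Fintype.card ι * (2 ^ Fintype.card ι * 2 ^ Fintype.card ι) := by
    rw [← mul_pow, ← mul_pow]; norm_num
  have h1 : (8 : ℝ) ^ Fintype.card ι * (2 / 3) ^ 13 ≤
      ∑ d : Finset ι, ∑ u, ∑ v, q (u ∩ d) (v ∩ dᶜ) ^ 13 := by
    calc (8 : ℝ) ^ Fintype.card ι * (2 / 3) ^ 13 =
        ∑ d : Finset ι, ∑ u : Finset ι, ∑ v : Finset ι, (2 / 3 : ℝ) ^ 13 := by
          simp only [sum_const, card_univ, Fintype.card_finset, nsmul_eq_mul, h8]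
          push_cast; ring
      _ ≤ _ := by
          refine sum_le_sum fun d _ => sum_le_sum fun u _ => sum_le_sum fun v _ => ?_
          refine pow_le_pow_left₀ (by norm_num) (hdisj _ _ ?_) _
          exact disjoint_compl_right.mono inter_subset_right inter_subset_right
  have h2 : ∑ i, ∑ d : Finset ι, ∑ u, ∑ v, q (insert i (u ∩ d)) (insert i (v ∩ dᶜ)) ^ 13 ≤
      Fintype.card ι * (8 ^ Fintype.card ι * (1 / 3) ^ 13) := by
    calc _ ≤ ∑ i : ι, ∑ d : Finset ι, ∑ u : Finset ι, ∑ v : Finset ι, (1 / 3 : ℝ) ^ 13 := by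
          refine sum_le_sum fun i _ => sum_le_sum fun d _ => sum_le_sum fun u _ =>
            sum_le_sum fun v _ => ?_
          refine pow_le_pow_left₀ ?_ (hinter _ _ ?_) _
          · exact sum_nonneg fun s _ => sum_nonneg fun θ _ => mul_nonneg (hw s)
              (mul_nonneg (nonneg_of_zero_or_one (ha s θ) _) (nonneg_of_zero_or_one (hb s θ) _))
          · exact not_disjoint_iff.2 ⟨i, mem_insert_self _ _, mem_insert_self _ _⟩
      _ = _ := by
          simp only [sum_const, card_univ, Fintype.card_finset, nsmul_eq_mul, h8]
          push_cast; ring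
  have h3 := mul_le_mul_of_nonneg_left h1 (show (0 : ℝ) ≤ Fintype.card ι / 3600 by positivity)
  have h5 : (0 : ℝ) < Fintype.card ι * 8 ^ Fintype.card ι := by positivity
  have h6 : (Fintype.card ι * 8 ^ Fintype.card ι : ℝ) * ((1 / 3600) * (2 / 3) ^ 13) ≤
      (Fintype.card ι * 8 ^ Fintype.card ι) * ((1 / 3) ^ 13 + Fintype.card Θ ^ 13 * e) := by
    linarith
  have h7 := le_of_mul_le_mul_left h6 h5
  -- Multiplied by `3 ^ 13`, the inequality requires `2 ^ 13 / 3600 - 1 ≥ 1`; 13 is the least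
  -- exponent for which this holds.
  have h9 : 1 ≤ (3 * Fintype.card Θ : ℝ) ^ 13 * e := by
    rw [mul_pow]
    norm_num at h7 ⊢
    linarith
  have h10 : Real.exp ((Fintype.card ι : ℝ) / 4096) * e = 1 := by
    rw [he, ← Real.exp_add, ← Real.exp_zero]; congr 1; ring
  have he0 : 0 < e := Real.exp_pos _
  rw [← h10] at h9
  exact le_of_mul_le_mul_right h9 he0

end Amplification
-- Simulation of a CONGEST algorithm across a matching cut.
section Congest

namespace CongestAlgorithm

variable {I Ω X Y : Type} {n B : ℕ} (A : CongestAlgorithm I n B Ω)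
  (G : X → Y → SimpleGraph (Fin n)) (inp : Fin n → I) (partner : Fin n → Fin n)

/-- What every node sends to its partner in each of the first `T` rounds. -/
noncomputable def transcript (ω : Ω) (T : ℕ) (x : X) (y : Y) :
    Fin T → Fin n → CongestMessage B :=
  fun t v => A.send (A.run (G x y) inp ω t v) (partner v)

variable {G} {partner} {side : Set (Fin n)}
  (hA : ∀ x y y', ∀ u ∈ side, ∀ v, (G x y).Adj u v ↔ (G x y').Adj u v)
  (hB : ∀ x x' y, ∀ u ∉ side, ∀ v, (G x y).Adj u v ↔ (G x' y).Adj u v)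
  (hcut : ∀ x y, ∀ u ∈ side, ∀ v ∉ side, (G x y).Adj u v → partner u = v ∧ partner v = u)
include hA hB hcut

/-- Cut and paste: inputs with equal transcripts may be recombined. -/
lemma run_eq_of_transcript_eq {ω : Ω} {T : ℕ} {x x' : X} {y y' : Y}
    (h : A.transcript G inp partner ω T x y = A.transcript G inp partner ω T x' y') :
    ∀ t ≤ T, (∀ u ∈ side, A.run (G x y') inp ω t u = A.run (G x y) inp ω t u) ∧
      ∀ u ∉ side, A.run (G x y') inp ω t u = A.run (G x' y') inp ω t u := by
  intro t
  induction t with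
  | zero =>
    refine fun _ => ⟨fun u hu => ?_, fun u hu => ?_⟩
    · have : (G x y').neighborSet u = (G x y).neighborSet u := Set.ext fun v => hA x y' y u hu v
      rw [run, run, this]
    · have : (G x y').neighborSet u = (G x' y').neighborSet u :=
        Set.ext fun v => hB x x' y' u hu v
      rw [run, run, this]
  | succ t ih =>
    intro ht
    obtain ⟨ihA, ihB⟩ := ih (by omega)
    have hm : ∀ v, A.send (A.run (G x y) inp ω t v) (partner v) =
        A.send (A.run (G x' y') inp ω t v) (partner v) := fun v =>
      congrFun (congrFun h ⟨t, by omega⟩) v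
    refine ⟨fun u hu => ?_, fun u hu => ?_⟩
    · rw [run, run, ihA u hu]
      congr 1
      funext v
      rw [hA x y' y u hu v]
      split_ifs with hadj
      · by_cases hv : v ∈ side
        · rw [ihA v hv]
        -- A neighbor across the cut is the partner, so its message is recorded in the transcript,
        -- which the two runs share.
        · rw [ihB v hv, ← (hcut x y u hu v hv hadj).2, ← hm]
      · rfl
    · rw [run, run, ihB u hu]
      congr 1
      funext v
      rw [hB x x' y' u hu v]
      split_ifs with hadj
      · by_cases hv : v ∈ side
        · rw [ihA v hv, ← (hcut x' y' v hv u hu hadj.symm).1, hm]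
        · rw [ihB v hv]
      · rfl

open Classical in
/-- The inputs on which no node reports form a disjoint union of rectangles, one for each
transcript. -/
lemma not_reports_eq_sum (ω : Ω) (T : ℕ) [Fintype (CongestMessage B)] :
    ∃ a : (Fin T → Fin n → CongestMessage B) → X → ℝ,
    ∃ b : (Fin T → Fin n → CongestMessage B) → Y → ℝ,
      (∀ θ x, a θ x = 0 ∨ a θ x = 1) ∧ (∀ θ y, b θ y = 0 ∨ b θ y = 1) ∧
      ∀ x y, (if A.Reports (G x y) inp T ω then 0 else 1) = ∑ θ, a θ x * b θ y := by
  refine ⟨fun θ x => if ∃ y, A.transcript G inp partner ω T x y = θ ∧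
      ∀ u ∈ side, A.output (A.run (G x y) inp ω T u) ≠ true then 1 else 0,
    fun θ y => if ∃ x, A.transcript G inp partner ω T x y = θ ∧
      ∀ u ∉ side, A.output (A.run (G x y) inp ω T u) ≠ true then 1 else 0,
    fun θ x => by beta_reduce; split_ifs <;> simp,
    fun θ y => by beta_reduce; split_ifs <;> simp, fun x y => ?_⟩
  -- "No node reports" is a conjunction of one condition per side, and the transcript allows each
  -- side to be certified by its own input.
  have key : ∀ θ, (∃ y', A.transcript G inp partner ω T x y' = θ ∧
      ∀ u ∈ side, A.output (A.run (G x y') inp ω T u) ≠ true) ∧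
      (∃ x', A.transcript G inp partner ω T x' y = θ ∧
      ∀ u ∉ side, A.output (A.run (G x' y) inp ω T u) ≠ true) ↔
      A.transcript G inp partner ω T x y = θ ∧ ¬ A.Reports (G x y) inp T ω := by
    intro θ
    constructor
    · rintro ⟨⟨y', h1, h2⟩, x', h3, h4⟩
      have hr := A.run_eq_of_transcript_eq inp hA hB hcut (h1.trans h3.symm)
      constructor
      · rw [← h1]
        funext t v
        by_cases hv : v ∈ side
        · rw [transcript, (hr t t.2.le).1 v hv, transcript]
        · rw [transcript, (hr t t.2.le).2 v hv, h1, ← h3, transcript]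
      · rintro ⟨v, hv⟩
        by_cases hs : v ∈ side
        · rw [(hr T le_rfl).1 v hs] at hv; exact h2 v hs hv
        · rw [(hr T le_rfl).2 v hs] at hv; exact h4 v hs hv
    · rintro ⟨h1, h2⟩
      exact ⟨⟨y, h1, fun u _ hu => h2 ⟨u, hu⟩⟩, x, h1, fun u _ hu => h2 ⟨u, hu⟩⟩
  have h1 : ∀ θ, (if ∃ y', A.transcript G inp partner ω T x y' = θ ∧
      ∀ u ∈ side, A.output (A.run (G x y') inp ω T u) ≠ true then (1 : ℝ) else 0) *
      (if ∃ x', A.transcript G inp partner ω T x' y = θ ∧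
      ∀ u ∉ side, A.output (A.run (G x' y) inp ω T u) ≠ true then 1 else 0) =
      if A.transcript G inp partner ω T x y = θ then
        (if A.Reports (G x y) inp T ω then 0 else 1) else 0 := by
    intro θ
    rw [ite_zero_mul_ite_zero, mul_one, if_congr (key θ) rfl rfl, ite_and, ite_not]
  rw [Finset.sum_congr rfl fun θ _ => h1 θ]
  simp

end CongestAlgorithm

lemma finite_congestMessage (B : ℕ) : Finite (CongestMessage B) :=
  Set.Finite.to_subtype (List.finite_length_le Bool B)

noncomputable instance (B : ℕ) : Fintype (CongestMessage B) :=
  have := finite_congestMessage B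
  Fintype.ofFinite _

/-- Each of the `B` positions holds a bit or lies past the end of the string: three possibilities.
-/
lemma card_congestMessage_le (B : ℕ) : Fintype.card (CongestMessage B) ≤ 3 ^ B := by
  have h : Function.Injective fun (w : CongestMessage B) (i : Fin B) => w.1[(i : ℕ)]? := by
    rintro ⟨w, hw⟩ ⟨w', hw'⟩ h
    refine Subtype.ext (List.ext_getElem? fun i => ?_)
    by_cases hi : i < B
    · exact congrFun h ⟨i, hi⟩
    · rw [List.getElem?_eq_none (by simp only; omega), List.getElem?_eq_none (by simp only; omega)]
  simpa using Fintype.card_le_of_injective _ h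

/-- A CONGEST algorithm deciding disjointness of the sets encoded on the two sides of a cut that
is a matching. -/
theorem exp_le_of_solves {ι Ω I : Type} [Fintype ι] [DecidableEq ι] [MeasurableSpace Ω]
    (μ : Measure Ω) [IsProbabilityMeasure μ] {n B : ℕ} (A : CongestAlgorithm I n B Ω)
    {P : SimpleGraph (Fin n) → (Fin n → I) → Prop} {T : ℕ} (hs : A.Solves μ P T)
    (G : Finset ι → Finset ι → SimpleGraph (Fin n)) (inp : Fin n → I)
    (hP : ∀ x y, P (G x y) inp ↔ ¬ Disjoint x y) (partner : Fin n → Fin n) (side : Set (Fin n))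
    (hA : ∀ x y y', ∀ u ∈ side, ∀ v, (G x y).Adj u v ↔ (G x y').Adj u v)
    (hB : ∀ x x' y, ∀ u ∉ side, ∀ v, (G x y).Adj u v ↔ (G x' y).Adj u v)
    (hcut : ∀ x y, ∀ u ∈ side, ∀ v ∉ side, (G x y).Adj u v → partner u = v ∧ partner v = u)
    (hι : 0 < Fintype.card ι) :
    Real.exp ((Fintype.card ι : ℝ) / 4096) ≤ (3 * 3 ^ (B * n * T) : ℝ) ^ 13 := by
  classical
  obtain ⟨w, seed, hw, hw1, hbad⟩ := exists_finite_seeds μ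
    (fun p : Finset ι × Finset ι => {ω | ¬ (A.Reports (G p.1 p.2) inp T ω ↔ P (G p.1 p.2) inp)})
    (fun p => hs _ _)
  choose a b ha hb hab using fun ω => A.not_reports_eq_sum inp hA hB hcut ω T
  have hsum : ∀ x y, ∑ s, ∑ θ, w s * (a (seed s) θ x * b (seed s) θ y) =
      ∑ s with ¬ A.Reports (G x y) inp T (seed s), w s := by
    intro x y
    rw [Finset.sum_filter]
    refine Finset.sum_congr rfl fun s _ => ?_
    rw [← Finset.mul_sum, ← hab]
    split_ifs <;> simp_all
  have h1 := exp_le_of_disjointness_protocol w hw hw1 (fun s => a (seed s)) (fun s => b (seed s))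
    (fun s => ha _) (fun s => hb _) (fun x y hxy => ?_) (fun x y hxy => ?_) hι
  · refine h1.trans ?_
    have h2 : Fintype.card (Fin T → Fin n → CongestMessage B) ≤ 3 ^ (B * n * T) := by
      rw [Fintype.card_fun, Fintype.card_fun, Fintype.card_fin, Fintype.card_fin, pow_mul,
        pow_mul]
      gcongr
      exact card_congestMessage_le B
    have h3 : (Fintype.card (Fin T → Fin n → CongestMessage B) : ℝ) ≤ 3 ^ (B * n * T) := by
      exact_mod_cast h2
    gcongr
  · rw [hsum]
    have h2 := hbad (x, y) ({s | A.Reports (G x y) inp T (seed s)} : Finset _) fun s hs => by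
      have h3 := (Finset.mem_filter.1 hs).2
      simp [hP, hxy, h3]
    have h4 := Finset.sum_filter_add_sum_filter_not Finset.univ
      (fun s => A.Reports (G x y) inp T (seed s)) w
    linarith
  · rw [hsum]
    refine hbad (x, y) _ fun s hs => ?_
    have h3 := (Finset.mem_filter.1 hs).2
    simp [hP, hxy, h3]

end Congest
-- The gadget graph and its multicolored induced paths.
section Gadget

variable {V : Type*} {m : ℕ}

/-- The oriented adjacency of the gadget: consecutive color classes are joined completely, except
for the classes `1, 2` and `4, 5`, which are joined by matchings; the classes `2, 4` and `1, 5` are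
joined by the complements of the bipartite graphs encoded by `x` and `y`. -/
def GadgetRel (col idx : V → ℕ) (x y : Finset (Fin m × Fin m)) (u v : V) : Prop :=
  (col v = col u + 1 ∧ (col u = 1 ∨ col u = 4 → idx u = idx v)) ∨
  (col u = 2 ∧ col v = 4 ∧ ∀ p ∈ x, ¬ ((p.1 : ℕ) = idx u ∧ (p.2 : ℕ) = idx v)) ∨
  (col u = 1 ∧ col v = 5 ∧ ∀ p ∈ y, ¬ ((p.1 : ℕ) = idx u ∧ (p.2 : ℕ) = idx v))

/-- The graph that has a multicolored induced path if and only if `x` and `y` intersect. -/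
def gadget (col idx : V → ℕ) (x y : Finset (Fin m × Fin m)) : SimpleGraph V :=
  SimpleGraph.fromRel (GadgetRel col idx x y)

lemma gadget_adj {col idx : V → ℕ} {x y : Finset (Fin m × Fin m)} {u v : V} :
    (gadget col idx x y).Adj u v ↔ GadgetRel col idx x y u v ∨ GadgetRel col idx x y v u := by
  rw [gadget, SimpleGraph.fromRel_adj, and_iff_right_iff_imp]
  rintro h rfl
  simp only [GadgetRel] at h
  omega

/-- For a common element `(j, i)`, the classes up to 3 use index `j` and the later ones `i`. Both
matching edges are then present, and the only possible chords, 2–4 and 1–5, are missing. -/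
lemma hasMulticoloredInducedPath_gadget {k : ℕ} (χ : V → Fin (k + 1))
    {idx : V → ℕ} (hnode : ∀ c ≤ k, ∀ i < m, ∃ v, (χ v : ℕ) = c ∧
      (c = 1 ∨ c = 2 ∨ c = 4 ∨ c = 5 → idx v = i))
    {x y : Finset (Fin m × Fin m)} (h : ¬ Disjoint x y) :
    HasMulticoloredInducedPath k (gadget (fun v => (χ v : ℕ)) idx x y) χ := by
  obtain ⟨⟨j, i⟩, hx, hy⟩ := Finset.not_disjoint_iff.1 h
  choose node hcol hidx using fun c : Fin (k + 1) =>
    hnode c (by omega) (if (c : ℕ) ≤ 3 then (j : ℕ) else i) (by split_ifs <;> omega)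
  have hnx : ∀ i' j' : ℕ, j' = j → i' = i →
      ¬ ∀ p ∈ x, ¬ ((p.1 : ℕ) = j' ∧ (p.2 : ℕ) = i') := fun i' j' h1 h2 h3 =>
    h3 _ hx ⟨h1.symm, h2.symm⟩
  have hny : ∀ i' j' : ℕ, j' = j → i' = i →
      ¬ ∀ p ∈ y, ¬ ((p.1 : ℕ) = j' ∧ (p.2 : ℕ) = i') := fun i' j' h1 h2 h3 =>
    h3 _ hy ⟨h1.symm, h2.symm⟩
  have hrel : ∀ a b : Fin (k + 1),
      GadgetRel (fun v => (χ v : ℕ)) idx x y (node a) (node b) ↔ (a : ℕ) + 1 = b := by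
    intro a b
    have ha := hidx a
    have hb := hidx b
    simp only [GadgetRel, hcol]
    constructor
    · rintro (h1 | h1 | h1)
      · omega
      · rw [if_pos (by omega)] at ha
        rw [if_neg (by omega)] at hb
        exact absurd h1.2.2 (hnx _ _ (ha (by omega)) (hb (by omega)))
      · rw [if_pos (by omega)] at ha
        rw [if_neg (by omega)] at hb
        exact absurd h1.2.2 (hny _ _ (ha (by omega)) (hb (by omega)))
    · intro h1
      refine Or.inl ⟨h1.symm, fun h2 => ?_⟩
      rw [ha (by omega), hb (by omega)]
      split_ifs <;> omega
  have hinj : Function.Injective fun a => χ (node a) := fun a b hab => by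
    have : (χ (node a) : ℕ) = χ (node b) := congrArg _ hab
    rw [hcol, hcol] at this
    exact Fin.ext this
  refine ⟨⟨⟨node, fun a b hab => hinj (congrArg χ hab)⟩, fun {a b} => ?_⟩, hinj⟩
  change (gadget _ idx x y).Adj (node a) (node b) ↔ _
  rw [gadget_adj, hrel, hrel, SimpleGraph.pathGraph_adj]

/-- The path has one node in each class. The complete joins force the edges 0–1, 2–3, 3–4 and 5–6;
connectedness and maximal degree 2 then force 1–2 and 4–5 and exclude 2–4 and 1–5. The matchings
equate the indices, so the two non-edges name one element of both sets. -/
lemma not_disjoint_of_hasMulticoloredInducedPath {k : ℕ} (hk : 6 ≤ k) (χ : V → Fin (k + 1))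
    {idx : V → ℕ} {x y : Finset (Fin m × Fin m)}
    (h : HasMulticoloredInducedPath k (gadget (fun v => (χ v : ℕ)) idx x y) χ) :
    ¬ Disjoint x y := by
  obtain ⟨f, hf⟩ := h
  obtain ⟨p, hp1, hp2⟩ := Function.bijective_iff_has_inverse.1
    (Finite.injective_iff_bijective.1 hf)
  -- `q c` is the position on the path of the node of color `c`; the `min` only extends it to all of
  -- `ℕ`.
  set q : ℕ → Fin (k + 1) := fun c => p ⟨min c k, by omega⟩ with hq
  set P : ℕ → ℕ := fun c => q c with hP
  have hcol : ∀ c ≤ k, (χ (f (q c)) : ℕ) = c := by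
    intro c hc
    have := congrArg Fin.val (hp2 ⟨min c k, by omega⟩)
    simpa [hq, hc] using this
  have hne : ∀ c c', c ≤ k → c' ≤ k → c ≠ c' → P c ≠ P c' := by
    intro c c' hc hc' h1 h2
    have : q c = q c' := Fin.ext h2
    rw [← hcol c hc, ← hcol c' hc', this] at h1
    exact h1 rfl
  have hE : ∀ c c', (GadgetRel (fun v => (χ v : ℕ)) idx x y (f (q c)) (f (q c')) ∨
      GadgetRel (fun v => (χ v : ℕ)) idx x y (f (q c')) (f (q c))) ↔
      (P c + 1 = P c' ∨ P c' + 1 = P c) := by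
    intro c c'
    rw [← gadget_adj, ← SimpleGraph.pathGraph_adj]
    exact f.map_adj_iff
  -- Connectedness of the path: some edge leaves every nonempty proper set of colors.
  have hleave : ∀ S : ℕ → Prop, (∃ c ≤ k, S c) → (∃ c ≤ k, ¬ S c) →
      ∃ c ≤ k, ∃ c' ≤ k, S c ∧ ¬ S c' ∧ (P c + 1 = P c' ∨ P c' + 1 = P c) := by
    rintro S ⟨c₀, h0, hS0⟩ ⟨c₁, h1, hS1⟩
    by_contra! hcon
    have hstep : ∀ t ≤ k, ∀ ht : t < k + 1, S (χ (f ⟨t, ht⟩)) ↔ S (χ (f 0)) := by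
      intro t
      induction t with
      | zero => exact fun _ _ => Iff.rfl
      | succ t ih =>
        intro h2 h3
        rw [← ih (by omega) (by omega)]
        have hqt : ∀ t : Fin (k + 1), q (χ (f t)) = t := by
          intro t
          have h4 : (⟨min (χ (f t) : ℕ) k, by omega⟩ : Fin (k + 1)) = χ (f t) :=
            Fin.ext (by simp; omega)
          rw [hq]
          exact (congrArg p h4).trans (hp1 t)
        have hPt : ∀ t : Fin (k + 1), P (χ (f t)) = t := fun t => congrArg Fin.val (hqt t)
        have k1 := hcon (χ (f ⟨t, by omega⟩)) (by omega) (χ (f ⟨t + 1, h3⟩)) (by omega)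
        have k2 := hcon (χ (f ⟨t + 1, h3⟩)) (by omega) (χ (f ⟨t, by omega⟩)) (by omega)
        rw [hPt, hPt] at k1 k2
        simp only at k1 k2
        by_contra h5
        by_cases h6 : S (χ (f ⟨t, by omega⟩))
        · have h7 : ¬ S (χ (f ⟨t + 1, h3⟩)) := fun h7 => h5 ⟨fun _ => h6, fun _ => h7⟩
          exact (k1 h6 h7).1 rfl
        · have h7 : S (χ (f ⟨t + 1, h3⟩)) := by
            by_contra h7
            exact h5 ⟨fun h => absurd h h7, fun h => absurd h h6⟩
          exact (k2 h7 h6).2 rfl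
    have hstep2 : ∀ c ≤ k, S c ↔ S (χ (f 0)) := by
      intro c hc
      have h2 := hstep (P c) (Nat.le_of_lt_succ (q c).isLt) (q c).isLt
      rwa [show (⟨P c, (q c).isLt⟩ : Fin (k + 1)) = q c from rfl, hcol c hc] at h2
    rw [hstep2 c₀ h0, ← hstep2 c₁ h1] at hS0
    exact hS1 hS0
  have hrel : ∀ c c', c ≤ k → c' ≤ k →
      (GadgetRel (fun v => (χ v : ℕ)) idx x y (f (q c)) (f (q c')) ↔
      (c' = c + 1 ∧ (c = 1 ∨ c = 4 → idx (f (q c)) = idx (f (q c')))) ∨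
      (c = 2 ∧ c' = 4 ∧
        ∀ p ∈ x, ¬ ((p.1 : ℕ) = idx (f (q c)) ∧ (p.2 : ℕ) = idx (f (q c')))) ∨
      (c = 1 ∧ c' = 5 ∧
        ∀ p ∈ y, ¬ ((p.1 : ℕ) = idx (f (q c)) ∧ (p.2 : ℕ) = idx (f (q c'))))) := by
    intro c c' hc hc'
    rw [GadgetRel]
    simp only [hcol c hc, hcol c' hc']
  have hclass : ∀ c c', c ≤ k → c' ≤ k → (P c + 1 = P c' ∨ P c' + 1 = P c) →
      c' = c + 1 ∨ c = c' + 1 ∨ (c = 2 ∧ c' = 4) ∨ (c = 4 ∧ c' = 2) ∨ (c = 1 ∧ c' = 5) ∨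
      (c = 5 ∧ c' = 1) := by
    intro c c' hc hc' h1
    rw [← hE, hrel c c' hc hc', hrel c' c hc' hc] at h1
    omega
  have e01 := (hE 0 1).1 (Or.inl ((hrel 0 1 (by omega) (by omega)).2 (by simp)))
  have e23 := (hE 2 3).1 (Or.inl ((hrel 2 3 (by omega) (by omega)).2 (by simp)))
  have e34 := (hE 3 4).1 (Or.inl ((hrel 3 4 (by omega) (by omega)).2 (by simp)))
  have e56 := (hE 5 6).1 (Or.inl ((hrel 5 6 (by omega) (by omega)).2 (by simp)))
  -- Both are next to the node of color 3, so their positions have equal parity.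
  have n24 : ¬ (P 2 + 1 = P 4 ∨ P 4 + 1 = P 2) := by omega
  have n02 := hne 0 2 (by omega) (by omega) (by omega)
  have n05 := hne 0 5 (by omega) (by omega) (by omega)
  have n25 := hne 2 5 (by omega) (by omega) (by omega)
  have n46 := hne 4 6 (by omega) (by omega) (by omega)
  have n41 := hne 4 1 (by omega) (by omega) (by omega)
  have n61 := hne 6 1 (by omega) (by omega) (by omega)
  have l1 : (P 1 + 1 = P 2 ∨ P 2 + 1 = P 1) ∨ (P 4 + 1 = P 5 ∨ P 5 + 1 = P 4) := by
    obtain ⟨c, hc, c', hc', h1, h2, h3⟩ := hleave (fun c => 2 ≤ c ∧ c ≤ 4) ⟨2, by omega, by omega⟩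
      ⟨0, by omega, by omega⟩
    have h4 := hclass c c' hc hc' h3
    have : (c = 2 ∧ c' = 1) ∨ (c = 4 ∧ c' = 5) := by omega
    rcases this with ⟨rfl, rfl⟩ | ⟨rfl, rfl⟩ <;> omega
  have l2 : (P 1 + 1 = P 5 ∨ P 5 + 1 = P 1) ∨ (P 4 + 1 = P 5 ∨ P 5 + 1 = P 4) := by
    obtain ⟨c, hc, c', hc', h1, h2, h3⟩ := hleave (fun c => 5 ≤ c) ⟨5, by omega, by omega⟩
      ⟨0, by omega, by omega⟩
    have h4 := hclass c c' hc hc' h3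
    have : (c = 5 ∧ c' = 1) ∨ (c = 5 ∧ c' = 4) := by omega
    rcases this with ⟨rfl, rfl⟩ | ⟨rfl, rfl⟩ <;> omega
  have l3 : (P 1 + 1 = P 5 ∨ P 5 + 1 = P 1) ∨ (P 1 + 1 = P 2 ∨ P 2 + 1 = P 1) := by
    obtain ⟨c, hc, c', hc', h1, h2, h3⟩ := hleave (fun c => c ≤ 1) ⟨0, by omega, by omega⟩
      ⟨2, by omega, by omega⟩
    have h4 := hclass c c' hc hc' h3
    have : (c = 1 ∧ c' = 5) ∨ (c = 1 ∧ c' = 2) := by omega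
    rcases this with ⟨rfl, rfl⟩ | ⟨rfl, rfl⟩ <;> omega
  -- With 1–5 present, `l1` would give a node with three neighbors: color 1 with 0, 2, 5 or color 5
  -- with 1, 4, 6.
  have n15 : ¬ (P 1 + 1 = P 5 ∨ P 5 + 1 = P 1) := by omega
  have e12 := l3.resolve_left n15
  have e45 := l2.resolve_left n15
  rw [← hE, hrel 1 2 (by omega) (by omega), hrel 2 1 (by omega) (by omega)] at e12
  rw [← hE, hrel 4 5 (by omega) (by omega), hrel 5 4 (by omega) (by omega)] at e45
  rw [← hE, hrel 2 4 (by omega) (by omega), hrel 4 2 (by omega) (by omega)] at n24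
  rw [← hE, hrel 1 5 (by omega) (by omega), hrel 5 1 (by omega) (by omega)] at n15
  simp at e12 e45 n24 n15
  obtain ⟨j, i, hx, hj, hi⟩ := n24
  obtain ⟨j', i', hy, hj', hi'⟩ := n15
  have hjj : j = j' := Fin.ext (by omega)
  have hii : i = i' := Fin.ext (by omega)
  subst hjj hii
  exact Finset.not_disjoint_iff.2 ⟨_, hx, hy⟩

end Gadget
-- Placing the gadget on the identifiers `0, …, n - 1`.
section Layout

/-- The color of each node of the gadget: four classes of size `m`, then one node for each other
color, the remaining nodes having color `3`. -/
def layoutColor (k m v : ℕ) : ℕ :=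
  if v < m then 1 else if v < 2 * m then 2 else if v < 3 * m then 4 else if v < 4 * m then 5
  else if v = 4 * m then 0 else if v + 5 ≤ 4 * m + k then v + 5 - 4 * m else 3

/-- The position of a node within its color class. -/
def layoutIndex (m v : ℕ) : ℕ :=
  if v < m then v else if v < 2 * m then v - m else if v < 3 * m then v - 2 * m
  else v - 3 * m

/-- The other endpoint of the matching edge at a node. -/
def layoutPartner (m v : ℕ) : ℕ :=
  if v < m then v + m else if v < 2 * m then v - m else if v < 3 * m then v + m
  else if v < 4 * m then v - m else v

lemma layoutColor_le {k : ℕ} (hk : 6 ≤ k) (m v : ℕ) : layoutColor k m v ≤ k := by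
  unfold layoutColor; split_ifs <;> omega

lemma layoutColor_eq_one {k m v : ℕ} (h : layoutColor k m v = 1) : v < m := by
  unfold layoutColor at h; split_ifs at h <;> omega

lemma layoutColor_eq_two {k m v : ℕ} (h : layoutColor k m v = 2) : m ≤ v ∧ v < 2 * m := by
  unfold layoutColor at h; split_ifs at h <;> omega

lemma layoutColor_eq_four {k m v : ℕ} (h : layoutColor k m v = 4) :
    2 * m ≤ v ∧ v < 3 * m := by
  unfold layoutColor at h; split_ifs at h <;> omega

lemma layoutColor_eq_five {k m v : ℕ} (h : layoutColor k m v = 5) :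
    3 * m ≤ v ∧ v < 4 * m := by
  unfold layoutColor at h; split_ifs at h <;> omega

lemma exists_layoutColor_eq {k m n c i : ℕ} (hk : 6 ≤ k) (hn : 4 * m + k ≤ n) (hc : c ≤ k)
    (hi : i < m) :
    ∃ v < n, layoutColor k m v = c ∧
      (c = 1 ∨ c = 2 ∨ c = 4 ∨ c = 5 → layoutIndex m v = i) := by
  have h : c = 0 ∨ c = 1 ∨ c = 2 ∨ c = 3 ∨ c = 4 ∨ c = 5 ∨ 6 ≤ c := by omega
  unfold layoutColor layoutIndex
  rcases h with rfl | rfl | rfl | rfl | rfl | rfl | h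
  · exact ⟨4 * m, by omega, by split_ifs <;> omega, by omega⟩
  · exact ⟨i, by omega, by rw [if_pos hi], fun _ => if_pos hi⟩
  · exact ⟨m + i, by omega, by split_ifs <;> omega, fun _ => by split_ifs <;> omega⟩
  · exact ⟨4 * m + k - 4, by omega, by split_ifs <;> omega, by omega⟩
  · exact ⟨2 * m + i, by omega, by split_ifs <;> omega, fun _ => by split_ifs <;> omega⟩
  · exact ⟨3 * m + i, by omega, by split_ifs <;> omega, fun _ => by split_ifs <;> omega⟩
  · exact ⟨4 * m + c - 5, by omega, by split_ifs <;> omega, by omega⟩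

/-- The coloring of the gadget on `n` nodes. -/
def layoutColoring {k : ℕ} (hk : 6 ≤ k) (m n : ℕ) (v : Fin n) : Fin (k + 1) :=
  ⟨layoutColor k m v, Nat.lt_succ_of_le (layoutColor_le hk m v)⟩

lemma layoutPartner_lt {m n v : ℕ} (hn : 4 * m ≤ n) (hv : v < n) : layoutPartner m v < n := by
  unfold layoutPartner; split_ifs <;> omega

lemma layoutPartner_eq_of_matched {k m u v : ℕ}
    (h : (layoutColor k m u = 1 ∧ layoutColor k m v = 2) ∨
      (layoutColor k m u = 4 ∧ layoutColor k m v = 5))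
    (hi : layoutIndex m u = layoutIndex m v) : layoutPartner m u = v ∧ layoutPartner m v = u := by
  rcases h with ⟨h1, h2⟩ | ⟨h1, h2⟩
  · have := layoutColor_eq_one h1
    have := layoutColor_eq_two h2
    unfold layoutIndex at hi
    unfold layoutPartner
    constructor <;> split_ifs at hi ⊢ <;> omega
  · have := layoutColor_eq_four h1
    have := layoutColor_eq_five h2
    unfold layoutIndex at hi
    unfold layoutPartner
    constructor <;> split_ifs at hi ⊢ <;> omega

/-- A CONGEST algorithm for multicolored induced paths solves set disjointness on `m * m` elements
across a cut of at most `n` edges. -/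
theorem exp_le_of_solves_path {k m n B T : ℕ} (hk : 6 ≤ k) (hm : 0 < m) (hn : 4 * m + k ≤ n)
    {Ω : Type} [MeasurableSpace Ω] (μ : Measure Ω) [IsProbabilityMeasure μ]
    (A : CongestAlgorithm (Fin (k + 1)) n B Ω)
    (hs : A.Solves μ (HasMulticoloredInducedPath k) T) :
    Real.exp ((m * m : ℝ) / 4096) ≤ (3 * 3 ^ (B * n * T) : ℝ) ^ 13 := by
  set χ := layoutColoring hk m n with hχ
  set idx : Fin n → ℕ := fun v => layoutIndex m v with hidx
  have key := exp_le_of_solves (ι := Fin m × Fin m) μ A hs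
    (fun x y => gadget (fun v => (χ v : ℕ)) idx x y) χ
    (fun x y => ⟨not_disjoint_of_hasMulticoloredInducedPath hk χ, ?_⟩)
    (fun v => ⟨layoutPartner m v, layoutPartner_lt (by omega) v.2⟩)
    -- The classes 2, 3, 4 contain all edges that depend on `x` and none that depends on `y`; only
    -- the two matchings cross.
    {v | 2 ≤ (χ v : ℕ) ∧ (χ v : ℕ) ≤ 4} ?_ ?_ ?_ ?_
  · simpa using key
  · refine hasMulticoloredInducedPath_gadget χ fun c hc i hi => ?_
    obtain ⟨v, hv, h1, h2⟩ := exists_layoutColor_eq hk hn hc hi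
    exact ⟨⟨v, hv⟩, h1, h2⟩
  · rintro x y y' u ⟨hu, hu'⟩ v
    have h1 : (χ u : ℕ) ≠ 1 := by omega
    have h5 : (χ u : ℕ) ≠ 5 := by omega
    simp only [gadget_adj, GadgetRel, h1, h5, false_and, and_false, or_false]
  · intro x x' y u hu v
    have h2 : (χ u : ℕ) ≠ 2 := fun h => hu ⟨by omega, by omega⟩
    have h4 : (χ u : ℕ) ≠ 4 := fun h => hu ⟨by omega, by omega⟩
    simp only [gadget_adj, GadgetRel, h2, h4, false_and, and_false, or_false, false_or]
  · rintro x y u ⟨hu, hu'⟩ v hv hadj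
    have hv' : (χ v : ℕ) < 2 ∨ 4 < (χ v : ℕ) := by
      by_contra! h
      exact hv ⟨by omega, by omega⟩
    rw [gadget_adj] at hadj
    have hmatch : (((χ u : ℕ) = 1 ∧ (χ v : ℕ) = 2 ∨ (χ u : ℕ) = 4 ∧ (χ v : ℕ) = 5) ∧
        idx u = idx v) ∨ (((χ v : ℕ) = 1 ∧ (χ u : ℕ) = 2 ∨ (χ v : ℕ) = 4 ∧ (χ u : ℕ) = 5) ∧
        idx v = idx u) := by
      simp only [GadgetRel] at hadj
      omega
    rcases hmatch with ⟨h1, h2⟩ | ⟨h1, h2⟩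
    · have := layoutPartner_eq_of_matched h1 h2
      exact ⟨Fin.ext this.1, Fin.ext this.2⟩
    · have := layoutPartner_eq_of_matched h1 h2
      exact ⟨Fin.ext this.2, Fin.ext this.1⟩
  · simpa using hm.ne'

end Layout

theorem mainTheorem12 (k : ℕ) (hk : 6 ≤ k) (β : ℝ) (hβ : 0 < β) :
    ∃ c : ℝ, 0 < c ∧ ∃ n₀ : ℕ, ∀ n : ℕ, n₀ ≤ n → ∀ B : ℕ, (B : ℝ) ≤ β * Real.log n →
      ∀ (Ω : Type) [MeasurableSpace Ω] (μ : Measure Ω) [IsProbabilityMeasure μ]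
        (A : CongestAlgorithm (Fin (k + 1)) n B Ω) (T : ℕ),
        A.Solves μ (HasMulticoloredInducedPath k) T →
          c * ((n : ℝ) / Real.log n) ≤ (T : ℝ) := by
  -- Here `5324800 = 2 * 25 * 4096 * 26`, from `n ≤ 5 * m`, the disjointness bound and `13 * log 3 ≤
  -- 26`. The factor 2 absorbs the additive 1 in `1 + B * n * T`, since `3000 ^ 2 ≥ 5324800`; the
  -- term `5 * k` yields `n ≤ 5 * m`.
  refine ⟨1 / (5324800 * β), by positivity, 5 * k + 3000, ?_⟩
  intro n hn B hB Ω _ μ _ A T hs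
  set m := (n - k) / 4 with hm
  have h1 := exp_le_of_solves_path hk (m := m) (by omega) (by omega) μ A hs
  have h3 : Real.log 3 ≤ 2 := by
    have := Real.log_le_sub_one_of_pos (show (0 : ℝ) < 3 by norm_num)
    linarith
  have h2 : (m * m : ℝ) / 4096 ≤ 13 * (1 + (B * n * T : ℕ)) * 2 := by
    rw [← pow_succ', ← pow_mul] at h1
    have := Real.log_le_log (Real.exp_pos _) h1
    rw [Real.log_exp, Real.log_pow] at this
    refine this.trans ?_
    push_cast
    have h4 := mul_le_mul_of_nonneg_left h3 (show (0 : ℝ) ≤ (B * n * T + 1) * 13 by positivity)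
    linarith
  have h5 : (n : ℝ) ≤ 5 * m := by
    have : n ≤ 5 * m := by omega
    exact_mod_cast this
  have hn3 : (3000 : ℝ) ≤ n := by
    have : 3000 ≤ n := by omega
    exact_mod_cast this
  have h6 : (n : ℝ) * n ≤ 25 * (m * m) := by nlinarith
  push_cast at h2
  have h7 : (n : ℝ) * n ≤ n * (5324800 * (B * T)) := by nlinarith
  have h8 := le_of_mul_le_mul_left h7 (by linarith)
  have hlog : 0 < Real.log n := Real.log_pos (by linarith)
  have h9 := mul_le_mul_of_nonneg_right hB (Nat.cast_nonneg (α := ℝ) T)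
  rw [div_mul_div_comm, one_mul, div_le_iff₀ (by positivity)]
  linarith
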